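/- Consider two transmission rates $u\in\{1,2\}$ (1 is the low rate, 2 the high rate) with transmission delays $d_u>0$ and error probabilities $p_u\in(0,1)$, where $d_1>d_2$ and $p_1<p_2$. Let $\mathcal S=\{l d_1+v d_2: l,v\in\{0,1,2,\dots\}\}$ be the set of ages and let $\beta\in\mathbb R$. Consider the Markov decision process with state space $\mathcal S$ and action set $\{1,2\}$ in which, from age $a$ under action $u$, the next age is $a+d_u$ with probability $p_u$ (failure) and $d_u$ with probability $1-p_u$ (success), and the cost of the stage is $$C(a,u)=(a-\beta)d_u+\tfrac12 d_u^2 .$$ The average cost of a policy $\pi$ from the initial age $s\in\mathcal S$ is $J(\pi,\beta;s)=\limsup_{n\to\infty}\frac1n\,\mathbb E_\pi^s\big[\sum_{i=0}^{n-1}C(a_i,u_i)\big]$. A policy is average-optimal if, for every initial age $s\in\mathcal S$, it minimizes $J(\cdot,\beta;s)$ over all causal (history-dependent, possibly randomized) policies. Then there exists a stationary deterministic average-optimal policy of threshold type. Specifically: (i) If $d_1(1-p_2)\le d_2(1-p_1)$, there is a threshold $a_1^*\in[0,\infty]$ such that the policy which uses rate $2$ at ages $a\le a_1^*$ and rate $1$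 at ages $a>a_1^*$ is average-optimal; if the inequality is strict, $a_1^*$ can be taken finite. (ii) If $d_1(1-p_2)\ge d_2(1-p_1)$, there is a threshold $a_2^*\in[0,\infty]$ such that the policy which uses rate $1$ at ages $a\le a_2^*$ and rate $2$ at ages $a>a_2^*$ is average-optimal; if the inequality is strict, $a_2^*$ can be taken finite. -/

import Mathlib

open Filter

namespace AgeMDP

/-- The two transmission rates: `low` is rate 1 and `high` is rate 2. -/
inductive Rate where
  | low
  | high

/-- The parameters of the system: rate `u` has transmission delay `d u` and transmission error
probability `p u`. The low rate is slower and more reliable than the high rate. -/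
structure Channel where
  /-- transmission delays -/
  d : Rate → ℝ
  /-- transmission error probabilities -/
  p : Rate → ℝ
  d_pos : ∀ u, 0 < d u
  p_pos : ∀ u, 0 < p u
  p_lt_one : ∀ u, p u < 1
  d_high_lt_low : d Rate.high < d Rate.low
  p_low_lt_high : p Rate.low < p Rate.high

namespace Channel

variable (M : Channel)

/-- The set of ages `l * d₁ + v * d₂` with `l, v ∈ {0, 1, …}`. -/
def ages : Set ℝ :=
  {a | ∃ l v : ℕ, a = l * M.d Rate.low + v * M.d Rate.high}

/-- The state space of the decision process. -/
abbrev State : Type := M.ages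

theorem d_mem_ages (u : Rate) : M.d u ∈ M.ages := by
  cases u
  · exact ⟨1, 0, by simp⟩
  · exact ⟨0, 1, by simp⟩

theorem add_d_mem_ages {a : ℝ} (ha : a ∈ M.ages) (u : Rate) : a + M.d u ∈ M.ages := by
  obtain ⟨l, v, rfl⟩ := ha
  cases u
  · exact ⟨l + 1, v, by push_cast; ring⟩
  · exact ⟨l, v + 1, by push_cast; ring⟩

/-- The age after a successful transmission at rate `u`. -/
def reset (u : Rate) : M.State := ⟨M.d u, M.d_mem_ages u⟩

/-- The age after a failed transmission at rate `u` that started at age `a`. -/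
def grow (a : M.State) (u : Rate) : M.State := ⟨a + M.d u, M.add_d_mem_ages a.2 u⟩

/-- The law of the outcome of a transmission at rate `u`: `true` (failure) with probability `p u`
and `false` (success) with probability `1 - p u`. -/
noncomputable def failure (u : Rate) : PMF Bool :=
  PMF.ofFintype (fun b => if b then ENNReal.ofReal (M.p u) else ENNReal.ofReal (1 - M.p u)) <| by
    rw [Fintype.sum_bool]
    simp only [if_true, Bool.false_eq_true, if_false]
    rw [← ENNReal.ofReal_add (M.p_pos u).le (sub_nonneg.2 (M.p_lt_one u).le)]
    simp

/-- The law of the next state: with probability `p u` the transmission fails and the age becomes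
`a + d u`; with probability `1 - p u` it succeeds and the age becomes `d u`. -/
noncomputable def transition (a : M.State) (u : Rate) : PMF M.State :=
  (M.failure u).map fun failed => if failed then M.grow a u else M.reset u

/-- The cost of a stage that starts at age `a` and uses rate `u`. -/
noncomputable def cost (β : ℝ) (a : M.State) (u : Rate) : ℝ :=
  ((a : ℝ) - β) * M.d u + (1 / 2) * M.d u ^ 2

/-- The past states and actions, most recent first. -/
abbrev History : Type := List (M.State × Rate)

/-- A causal policy: from the history of states and actions (whose length is the index of the
current stage) and the current state it gives the action to take, which may be drawn at random. -/
abbrev Policy : Type := M.History → M.State → PMF Rate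

/-- The stationary deterministic policy that always takes the action `ζ a` at age `a`. -/
noncomputable def stationary (ζ : M.State → Rate) : M.Policy := fun _ a => PMF.pure (ζ a)

/-- The joint law of the history of the first `n` stages and of the state reached after them,
under the policy `π` and from the initial state `s`. Its support is finite. -/
noncomputable def law (π : M.Policy) (s : M.State) : ℕ → PMF (M.History × M.State)
  | 0 => PMF.pure ([], s)
  | n + 1 => (law π s n).bind fun x =>
      (π x.1 x.2).bind fun u =>
        (M.transition x.2 u).map fun a' => ((x.2, u) :: x.1, a')

/-- The total cost of the stages that a history records. -/
noncomputable def totalCost (β : ℝ) (h : M.History) : ℝ :=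
  (h.map fun x => M.cost β x.1 x.2).sum

/-- The expected total cost of the first `n` stages. -/
noncomputable def expectedCost (β : ℝ) (π : M.Policy) (s : M.State) (n : ℕ) : ℝ :=
  ∑' x : M.History × M.State, (M.law π s n x).toReal * M.totalCost β x.1

/-- The average cost per stage, the upper limit of the expected total cost of the first `n`
stages divided by `n`, as an extended real number. -/
noncomputable def averageCost (β : ℝ) (π : M.Policy) (s : M.State) : EReal :=
  limsup (fun n : ℕ => ((M.expectedCost β π s n / n : ℝ) : EReal)) atTop

/-- A policy is average-optimal if from every initial state it minimizes the average cost per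
stage over all causal policies. -/
def IsAverageOptimal (β : ℝ) (π : M.Policy) : Prop :=
  ∀ (s : M.State) (π' : M.Policy), M.averageCost β π s ≤ M.averageCost β π' s

open Classical in
/-- Rate `u` at ages up to the threshold `θ`, and rate `v` above it. -/
noncomputable def threshold (u v : Rate) (θ : EReal) (a : M.State) : Rate :=
  if ((a : ℝ) : EReal) ≤ θ then u else v

end Channel

end AgeMDP

/-!
The two parts are the same statement with the rates exchanged: if
`d v * (1 - p u) ≤ d u * (1 - p v)`, it is optimal to use `u` at small ages and `v` at large ones.

Let `m = d v / (1 - p v)`, the slope in the age of the expected cost until the first success when `v`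
is used throughout. By the assumption no other sequence of rates has a smaller slope, so subtracting
`m * a` from the value function of the problem that stops at the first success leaves a bounded
function. It is the fixed point `value` of a contraction `bellman` on bounded continuous functions of
the age, which depends continuously and monotonically on the average cost `g` and on the difference
`δ` of the values of the two reset states. Two applications of the intermediate value theorem
(`exists_value_reset_eq`) give `g` and `δ` for which the values at the reset states are consistent,
that is, a solution of the average cost optimality equation.

The threshold comes from an interchange argument. If both rates fail in turn, their order does not
matter for the age reached. Hence the cost of `u` minus that of `v`, as a function of the age, is
reproduced by value iteration as an affine function of slope
`d u * (1 - p v) - d v * (1 - p u) ≥ 0` plus monotone functions of itself (`advantage_bellman`). So it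
is nondecreasing (`monotone_advantage_value`), and unbounded above if the inequality is strict
(`le_advantage_value`).

Finally, the optimality equation yields average optimality (`le_averageCost`,
`averageCost_stationary_le`), since the expected age is bounded along every policy and the relative
value grows at most linearly with the age.
-/

open scoped NNReal BoundedContinuousFunction Topology

namespace AgeMDP

namespace Channel

variable (M : Channel)

/-! ### The dynamic programming operator between two resets -/

/-- The transmission delay as a nonnegative real number. -/
def delay (r : Rate) : ℝ≥0 := ⟨M.d r, (M.d_pos r).le⟩

@[simp] theorem coe_delay (r : Rate) : (M.delay r : ℝ) = M.d r := rfl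

/-- The dynamic programming operator of the problem that stops at the first success, for value
functions from which a linear function of the age has been subtracted so that what remains is
bounded. Rate `u` has the stage cost `e * a + w.1` and rate `v` has the stage cost `w.2`; the value
after a success is part of `w`. -/
noncomputable def bellman (u v : Rate) (e : ℝ≥0) (w : ℝ × ℝ) (k : ℝ≥0 →ᵇ ℝ) : ℝ≥0 →ᵇ ℝ :=
  BoundedContinuousFunction.ofNormedAddCommGroup
    (fun a => min (e * a + w.1 + M.p u * k (a + M.delay u)) (w.2 + M.p v * k (a + M.delay v)))
    (by fun_prop) (|w.1| + |w.2| + ‖k‖) (by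
      intro a
      have bound : ∀ r, |M.p r * k (a + M.delay r)| ≤ ‖k‖ := fun r => by
        rw [abs_mul, abs_of_pos (M.p_pos r)]
        exact (mul_le_of_le_one_left (abs_nonneg _) (M.p_lt_one r).le).trans
          (k.norm_coe_le_norm _)
      have hu := abs_le.1 (bound u)
      have hv := abs_le.1 (bound v)
      have hea : (0 : ℝ) ≤ e * a := by positivity
      have h1 := abs_nonneg w.1
      have h2 := abs_nonneg w.2
      have h3 := neg_abs_le w.1
      have h4 := neg_abs_le w.2
      have h5 := le_abs_self w.2
      rw [Real.norm_eq_abs, abs_le]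
      exact ⟨le_min (by linarith) (by linarith), (min_le_right _ _).trans (by linarith)⟩)

variable (u v : Rate) (e : ℝ≥0)

theorem bellman_apply (w : ℝ × ℝ) (k : ℝ≥0 →ᵇ ℝ) (a : ℝ≥0) :
    M.bellman u v e w k a =
      min (e * a + w.1 + M.p u * k (a + M.delay u)) (w.2 + M.p v * k (a + M.delay v)) := rfl

theorem bellman_mono {w w' : ℝ × ℝ} {k k' : ℝ≥0 →ᵇ ℝ} (hw : w ≤ w') (hk : ∀ a, k a ≤ k' a)
    (a : ℝ≥0) : M.bellman u v e w k a ≤ M.bellman u v e w' k' a := by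
  have hu := mul_le_mul_of_nonneg_left (hk (a + M.delay u)) (M.p_pos u).le
  have hv := mul_le_mul_of_nonneg_left (hk (a + M.delay v)) (M.p_pos v).le
  have h1 := hw.1
  have h2 := hw.2
  exact min_le_min (by linarith) (by linarith)

/-- The larger of two failure probabilities, the contraction constant of `bellman`. -/
noncomputable def maxFailure : ℝ≥0 :=
  ⟨max (M.p u) (M.p v), le_max_of_le_left (M.p_pos u).le⟩

theorem maxFailure_lt_one : M.maxFailure u v < 1 := by
  rw [← NNReal.coe_lt_coe]
  exact max_lt (M.p_lt_one u) (M.p_lt_one v)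

theorem contracting_bellman (w : ℝ × ℝ) :
    ContractingWith (M.maxFailure u v) (M.bellman u v e w) := by
  refine ⟨M.maxFailure_lt_one u v, LipschitzWith.of_dist_le_mul fun k k' => ?_⟩
  have hK : (0 : ℝ) ≤ M.maxFailure u v * dist k k' := by positivity
  refine (BoundedContinuousFunction.dist_le hK).2 fun a => ?_
  have bound : ∀ r, M.p r ≤ M.maxFailure u v → ∀ b,
      |M.p r * k b - M.p r * k' b| ≤ M.maxFailure u v * dist k k' := fun r hr b => by
    rw [← mul_sub, abs_mul, abs_of_pos (M.p_pos r), ← Real.dist_eq]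
    exact mul_le_mul hr (BoundedContinuousFunction.dist_coe_le_dist b) dist_nonneg
      (NNReal.coe_nonneg _)
  rw [Real.dist_eq, bellman_apply, bellman_apply]
  refine (abs_min_sub_min_le_max _ _ _ _).trans (max_le ?_ ?_)
  · rw [add_sub_add_left_eq_sub]
    exact bound u (le_max_left _ _) _
  · rw [add_sub_add_left_eq_sub]
    exact bound v (le_max_right _ _) _

/-- The fixed point of `bellman`. -/
noncomputable def value (w : ℝ × ℝ) : ℝ≥0 →ᵇ ℝ :=
  ContractingWith.fixedPoint (M.bellman u v e w) (M.contracting_bellman u v e w)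

theorem bellman_value (w : ℝ × ℝ) : M.bellman u v e w (M.value u v e w) = M.value u v e w :=
  ContractingWith.fixedPoint_isFixedPt (M.contracting_bellman u v e w)

theorem value_eq (w : ℝ × ℝ) (a : ℝ≥0) :
    M.value u v e w a =
      min (e * a + w.1 + M.p u * M.value u v e w (a + M.delay u))
        (w.2 + M.p v * M.value u v e w (a + M.delay v)) := by
  rw [← bellman_apply, bellman_value]

/-- Value iteration: a closed set of functions that `bellman` maps to itself contains the fixed
point as soon as it is nonempty. -/
theorem value_mem {w : ℝ × ℝ} {S : Set (ℝ≥0 →ᵇ ℝ)} (hS : IsClosed S) {k₀ : ℝ≥0 →ᵇ ℝ}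
    (h₀ : k₀ ∈ S) (hmaps : Set.MapsTo (M.bellman u v e w) S S) : M.value u v e w ∈ S := by
  refine hS.mem_of_tendsto ((M.contracting_bellman u v e w).tendsto_iterate_fixedPoint k₀)
    (Eventually.of_forall fun n => ?_)
  exact hmaps.iterate n h₀

theorem le_value {w : ℝ × ℝ} {k : ℝ≥0 →ᵇ ℝ} (hk : ∀ a, k a ≤ M.bellman u v e w k a) (a : ℝ≥0) :
    k a ≤ M.value u v e w a := by
  have hS : IsClosed {f : ℝ≥0 →ᵇ ℝ | ∀ a, k a ≤ f a} := by
    simp only [Set.ofPred_forall]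
    exact isClosed_iInter fun a => isClosed_le continuous_const (by fun_prop)
  exact M.value_mem u v e hS (k₀ := k) (fun _ => le_rfl)
    (fun f hf a => (hk a).trans (M.bellman_mono u v e le_rfl hf a)) a

theorem value_mono {w w' : ℝ × ℝ} (hw : w ≤ w') (a : ℝ≥0) :
    M.value u v e w a ≤ M.value u v e w' a := by
  refine M.le_value u v e (fun b => ?_) a
  conv_lhs => rw [← bellman_value]
  exact M.bellman_mono u v e hw (fun _ => le_rfl) b

/-- At least one stage is played before the reset, so raising all stage costs by `t` raises the
value by at least `t`. -/
theorem value_add_le {t : ℝ} (ht : 0 ≤ t) (w : ℝ × ℝ) (a : ℝ≥0) :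
    M.value u v e w a + t ≤ M.value u v e (w.1 + t, w.2 + t) a := by
  refine M.le_value u v e (k := M.value u v e w + BoundedContinuousFunction.const _ t)
    (fun b => ?_) a
  have hu := mul_nonneg (M.p_pos u).le ht
  have hv := mul_nonneg (M.p_pos v).le ht
  simp only [bellman_apply, BoundedContinuousFunction.coe_add, Pi.add_apply,
    BoundedContinuousFunction.const_apply]
  rw [M.value_eq u v e w b, ← min_add_add_right]
  exact min_le_min (by linarith) (by linarith)

theorem continuous_value : Continuous (M.value u v e) := by
  have hK : (0 : ℝ) < 1 - M.maxFailure u v := by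
    have := M.maxFailure_lt_one u v
    rw [← NNReal.coe_lt_coe] at this
    simpa using this
  have key : ∀ w w', dist (M.value u v e w) (M.value u v e w') ≤
      (1 - M.maxFailure u v : ℝ)⁻¹ * dist w w' := fun w w' => by
    rw [inv_mul_eq_div]
    refine (M.contracting_bellman u v e w).fixedPoint_lipschitz_in_map
      (M.contracting_bellman u v e w') fun k => ?_
    refine (BoundedContinuousFunction.dist_le dist_nonneg).2 fun a => ?_
    rw [Real.dist_eq, bellman_apply, bellman_apply]
    refine (abs_min_sub_min_le_max _ _ _ _).trans (max_le ?_ ?_)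
    · rw [add_sub_add_right_eq_sub, add_sub_add_left_eq_sub]
      exact le_max_left _ _
    · rw [add_sub_add_right_eq_sub]
      exact le_max_right _ _
  exact (LipschitzWith.of_dist_le_mul (K := ⟨_, (inv_pos.2 hK).le⟩) key).continuous

/-- The dependence of the value on the age, uniformly in the constant parts of the costs. -/
theorem abs_value_sub_le : ∃ C : ℝ, ∀ (w : ℝ × ℝ) (a b : ℝ≥0),
    |M.value u v e w a - M.value u v e w b| ≤ C * dist a b := by
  have hK : (0 : ℝ) < 1 - M.maxFailure u v := by
    have := M.maxFailure_lt_one u v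
    rw [← NNReal.coe_lt_coe] at this
    simpa using this
  -- `C` solves `C = e + K * C` for the contraction constant `K`.
  set C : ℝ := e / (1 - M.maxFailure u v) with hC
  have hC0 : 0 ≤ C := by positivity
  have hfix : e + M.maxFailure u v * C = C := by
    rw [hC]; field_simp; ring
  refine ⟨C, fun w => ?_⟩
  have hS : IsClosed {f : ℝ≥0 →ᵇ ℝ | ∀ a b, |f a - f b| ≤ C * dist a b} := by
    simp only [Set.ofPred_forall]
    exact isClosed_iInter fun a => isClosed_iInter fun b =>
      isClosed_le (by fun_prop) continuous_const
  refine M.value_mem u v e hS (k₀ := 0) (fun a b => ?_) fun f hf a b => ?_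
  · simp only [BoundedContinuousFunction.coe_zero, Pi.zero_apply, sub_self, abs_zero]
    positivity
  have bound : ∀ r, M.p r ≤ M.maxFailure u v →
      |M.p r * f (a + M.delay r) - M.p r * f (b + M.delay r)| ≤
        M.maxFailure u v * C * dist a b := fun r hr => by
    rw [← mul_sub, abs_mul, abs_of_pos (M.p_pos r), mul_assoc]
    refine mul_le_mul hr ?_ (abs_nonneg _) (NNReal.coe_nonneg _)
    have := hf (a + M.delay r) (b + M.delay r)
    rwa [NNReal.dist_eq, NNReal.coe_add, NNReal.coe_add, add_sub_add_right_eq_sub,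
      ← NNReal.dist_eq] at this
  rw [bellman_apply, bellman_apply]
  refine (abs_min_sub_min_le_max _ _ _ _).trans (max_le ?_ ?_)
  · have h1 : |(e : ℝ) * a - e * b| = e * dist a b := by
      rw [← mul_sub, abs_mul, abs_of_nonneg e.coe_nonneg, NNReal.dist_eq]
    calc |(e * a + w.1 + M.p u * f (a + M.delay u)) - (e * b + w.1 + M.p u * f (b + M.delay u))|
        = |((e : ℝ) * a - e * b) + (M.p u * f (a + M.delay u) - M.p u * f (b + M.delay u))| := by
          congr 1; ring
      _ ≤ e * dist a b + M.maxFailure u v * C * dist a b :=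
          (abs_add_le _ _).trans (add_le_add h1.le (bound u (le_max_left _ _)))
      _ = C * dist a b := by rw [← add_mul, hfix]
  · rw [add_sub_add_left_eq_sub]
    refine (bound v (le_max_right _ _)).trans (mul_le_mul_of_nonneg_right ?_ dist_nonneg)
    linarith [e.coe_nonneg]

/-! ### The advantage of one rate over the other -/

/-- The cost of rate `u` minus that of rate `v` at age `a`, up to the constant `w.1 - w.2`, when `k`
is the value after a failure. -/
def advantage (k : ℝ≥0 →ᵇ ℝ) (a : ℝ≥0) : ℝ :=
  e * a + M.p u * k (a + M.delay u) - M.p v * k (a + M.delay v)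

/-- The interchange identity: after two failures the order of the two rates does not matter, so the
advantage for `bellman k` is an affine function of the age plus nondecreasing functions of the
advantage for `k`. -/
theorem advantage_bellman (w : ℝ × ℝ) (k : ℝ≥0 →ᵇ ℝ) (a : ℝ≥0) :
    M.advantage u v e (M.bellman u v e w k) a =
      (1 - M.p v) * e * a + (M.p u * w.2 - M.p v * (e * M.d v + w.1))
        + M.p u * min (w.1 - w.2 + M.advantage u v e k (a + M.delay u)) 0
        + M.p v * max (w.1 - w.2 + M.advantage u v e k (a + M.delay v)) 0 := by
  have h1 : ∀ x y : ℝ, min x y = y + min (x - y) 0 := fun x y => by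
    rw [← min_add_add_left]; simp
  have h2 : ∀ x y : ℝ, min x y = x - max (x - y) 0 := fun x y => by
    rw [← min_sub_sub_left]; simp [min_comm]
  have h3 : ∀ b, w.1 - w.2 + M.advantage u v e k b =
      (e * b + w.1 + M.p u * k (b + M.delay u)) - (w.2 + M.p v * k (b + M.delay v)) := fun b => by
    rw [advantage]; ring
  rw [h3, h3, advantage, bellman_apply, bellman_apply,
    h1 (_ + M.p u * k (a + M.delay u + M.delay u)),
    h2 _ (_ + M.p v * k (a + M.delay v + M.delay v)),
    add_right_comm a (M.delay v) (M.delay u)]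
  push_cast [coe_delay]
  ring

/-- Both terms of the interchange identity that involve the advantage preserve monotonicity, and the
affine term is nondecreasing. -/
theorem monotone_advantage_value (w : ℝ × ℝ) :
    Monotone (M.advantage u v e (M.value u v e w)) := by
  have hS : IsClosed {k : ℝ≥0 →ᵇ ℝ |
      ∀ a b, a ≤ b → M.advantage u v e k a ≤ M.advantage u v e k b} := by
    simp only [Set.ofPred_forall]
    refine isClosed_iInter fun a => isClosed_iInter fun b => isClosed_iInter fun _ => ?_
    refine isClosed_le ?_ ?_ <;> · unfold advantage; fun_prop
  have := M.value_mem u v e (w := w) hS (k₀ := 0) (fun a b hab => ?_) fun k hk a b hab => ?_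
  · exact fun a b hab => this a b hab
  · have : (e : ℝ) * a ≤ e * b := by gcongr
    simpa [advantage] using this
  · have hp := (M.p_pos u).le
    have hq := (M.p_pos v).le
    have hq' : 0 ≤ 1 - M.p v := by linarith [M.p_lt_one v]
    rw [advantage_bellman, advantage_bellman]
    gcongr
    · exact hk _ _ (by gcongr)
    · exact hk _ _ (by gcongr)

/-- The advantage grows at least as fast as the affine term of the interchange identity. -/
theorem le_advantage_value (w : ℝ × ℝ) (a : ℝ≥0) :
    M.advantage u v e (M.value u v e w) 0 + (1 - M.p v) * e * a ≤
      M.advantage u v e (M.value u v e w) a := by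
  have hp := (M.p_pos u).le
  have hq := (M.p_pos v).le
  have hmono : ∀ r, w.1 - w.2 + M.advantage u v e (M.value u v e w) (0 + M.delay r) ≤
      w.1 - w.2 + M.advantage u v e (M.value u v e w) (a + M.delay r) := fun r => by
    gcongr
    exact M.monotone_advantage_value u v e w (by gcongr; exact zero_le)
  have h1 := mul_le_mul_of_nonneg_left (min_le_min_right 0 (hmono u)) hp
  have h2 := mul_le_mul_of_nonneg_left (max_le_max_right 0 (hmono v)) hq
  conv_lhs => rw [← M.bellman_value u v e w]
  conv_rhs => rw [← M.bellman_value u v e w]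
  rw [advantage_bellman, advantage_bellman]
  simp only [NNReal.coe_zero]
  linarith

theorem continuous_advantage (k : ℝ≥0 →ᵇ ℝ) : Continuous (M.advantage u v e k) := by
  unfold advantage
  fun_prop

/-! ### Matching the values after a reset -/

/-- The constants `g` (the average cost) and `δ` (the difference of the values of the two reset
states) can be chosen so that the value takes prescribed values at the ages after a success. For
fixed `δ` the value is strictly decreasing in `g`, which determines `g` as a nonexpansive function
of `δ`; the difference of the values at the two reset ages is bounded uniformly, and the
intermediate value theorem yields `δ`. -/
theorem exists_value_reset_eq (c₁ c₂ y z q : ℝ) (hq₀ : 0 ≤ q) (hq₁ : q ≤ 1) : ∃ g δ : ℝ,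
    M.value u v e (c₁ - g + q * δ, c₂ - g) (M.delay v) = y ∧
    M.value u v e (c₁ - g + q * δ, c₂ - g) (M.delay u) = δ - z := by
  set k : ℝ → ℝ → ℝ≥0 →ᵇ ℝ := fun g δ => M.value u v e (c₁ - g + q * δ, c₂ - g)
  have hcont : Continuous fun x : ℝ × ℝ => k x.1 x.2 :=
    (M.continuous_value u v e).comp (by fun_prop)
  have hdecr : ∀ g t δ a, 0 ≤ t → k (g + t) δ a + t ≤ k g δ a := fun g t δ a ht => by
    have := M.value_add_le u v e ht (c₁ - (g + t) + q * δ, c₂ - (g + t)) a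
    rwa [show c₁ - (g + t) + q * δ + t = c₁ - g + q * δ by ring,
      show c₂ - (g + t) + t = c₂ - g by ring] at this
  have hmono : ∀ {g g' δ δ'} a, c₁ - g + q * δ ≤ c₁ - g' + q * δ' → g' ≤ g → k g δ a ≤ k g' δ' a :=
    fun a h1 h2 => M.value_mono u v e (Prod.mk_le_mk.2 ⟨h1, by linarith⟩) a
  have heval : ∀ a, Continuous fun f : ℝ≥0 →ᵇ ℝ => f a := fun a => by fun_prop
  have hroot : ∀ δ, ∃ g, k g δ (M.delay v) = y := fun δ => by
    have hc : Continuous fun g => k g δ (M.delay v) :=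
      (heval (M.delay v)).comp
        (hcont.comp (by fun_prop : Continuous fun g : ℝ => (g, δ)))
    refine mem_range_of_exists_le_of_exists_ge hc
      ⟨0 + |k 0 δ (M.delay v) - y|, ?_⟩ ⟨-|k 0 δ (M.delay v) - y|, ?_⟩
    · have := hdecr 0 _ δ (M.delay v) (abs_nonneg (k 0 δ (M.delay v) - y))
      linarith [le_abs_self (k 0 δ (M.delay v) - y)]
    · have := hdecr (-|k 0 δ (M.delay v) - y|) _ δ (M.delay v) (abs_nonneg (k 0 δ (M.delay v) - y))
      rw [neg_add_cancel] at this
      linarith [neg_abs_le (k 0 δ (M.delay v) - y)]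
  choose γ hγ using hroot
  have hle : ∀ {g g' δ}, k g δ (M.delay v) ≤ k g' δ (M.delay v) → g' ≤ g := by
    intro g g' δ h
    by_contra! hlt
    have := hdecr g (g' - g) δ (M.delay v) (by linarith)
    rw [add_sub_cancel] at this
    linarith
  have hγ_mono : ∀ δ t, 0 ≤ t → γ δ ≤ γ (δ + t) ∧ γ (δ + t) ≤ γ δ + t := fun δ t ht => by
    have hqt : 0 ≤ q * t := mul_nonneg hq₀ ht
    have hqt' : q * t ≤ t := mul_le_of_le_one_left ht hq₁
    constructor
    · refine hle (δ := δ + t) ?_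
      rw [hγ, ← hγ δ]
      exact hmono _ (by linarith) le_rfl
    · refine hle (δ := δ + t) ?_
      rw [hγ, ← hγ δ]
      exact hmono _ (by linarith) (by linarith)
  have hγ_cont : Continuous γ := by
    refine (LipschitzWith.of_le_add fun x x' => ?_).continuous
    rcases le_total x x' with h | h
    · have := (hγ_mono x (x' - x) (by linarith)).1
      rw [add_sub_cancel] at this
      linarith [dist_nonneg (x := x) (y := x')]
    · have := (hγ_mono x' (x - x') (by linarith)).2
      rw [add_sub_cancel] at this
      linarith [le_abs_self (x - x'), Real.dist_eq x x']
  obtain ⟨C, hC⟩ := M.abs_value_sub_le u v e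
  set B : ℝ := C * dist (M.delay u) (M.delay v)
  have hB : ∀ δ, |k (γ δ) δ (M.delay u) - y| ≤ B := fun δ => by
    rw [← hγ δ]
    exact hC _ _ _
  have hc : Continuous fun δ => k (γ δ) δ (M.delay u) - δ :=
    ((heval (M.delay u)).comp
      (hcont.comp (hγ_cont.prodMk continuous_id))).sub continuous_id
  obtain ⟨δ, hδ⟩ : -z ∈ Set.range fun δ => k (γ δ) δ (M.delay u) - δ := by
    refine mem_range_of_exists_le_of_exists_ge hc ⟨y + z + B, ?_⟩ ⟨y + z - B, ?_⟩
    · linarith [(abs_le.1 (hB (y + z + B))).2]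
    · linarith [(abs_le.1 (hB (y + z - B))).1]
  exact ⟨γ δ, δ, hγ δ, by linarith⟩

end Channel

/-! ### Expectations under finitely supported laws -/

/-- The expectation of `f` under `μ`. It is only used for `μ` of finite support, where the series is
a finite sum. -/
noncomputable def expect {α : Type*} (μ : PMF α) (f : α → ℝ) : ℝ := ∑' x, (μ x).toReal * f x

section expect

variable {α γ : Type*} {μ : PMF α} {f f' : α → ℝ}

theorem expect_eq_sum {s : Finset α} (hs : μ.support ⊆ s) (f : α → ℝ) :
    expect μ f = ∑ x ∈ s, (μ x).toReal * f x := by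
  refine tsum_eq_sum fun x hx => ?_
  have : μ x = 0 := by
    rw [PMF.apply_eq_zero_iff]
    exact fun h => hx (hs h)
  simp [this]

theorem expect_mono (hμ : μ.support.Finite) (h : ∀ x, f x ≤ f' x) : expect μ f ≤ expect μ f' := by
  rw [expect_eq_sum hμ.coe_toFinset.ge, expect_eq_sum hμ.coe_toFinset.ge]
  exact Finset.sum_le_sum fun x _ => mul_le_mul_of_nonneg_left (h x) ENNReal.toReal_nonneg

theorem expect_add (hμ : μ.support.Finite) :
    expect μ (fun x => f x + f' x) = expect μ f + expect μ f' := by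
  simp only [expect_eq_sum hμ.coe_toFinset.ge, mul_add, Finset.sum_add_distrib]

theorem expect_const_mul (c : ℝ) : expect μ (fun x => c * f x) = c * expect μ f := by
  simp only [expect, mul_left_comm _ c, tsum_mul_left]

theorem expect_const (μ : PMF α) (c : ℝ) : expect μ (fun _ => c) = c := by
  rw [expect, tsum_mul_right, ← ENNReal.tsum_toReal_eq μ.apply_ne_top, μ.tsum_coe]
  simp

theorem expect_pure (x : α) (f : α → ℝ) : expect (PMF.pure x) f = f x := by
  rw [expect_eq_sum (s := {x}) (by simp)]
  simp

theorem finite_support_bind {κ : α → PMF γ} (hμ : μ.support.Finite)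
    (hκ : ∀ x, (κ x).support.Finite) : (μ.bind κ).support.Finite := by
  rw [PMF.support_bind]
  exact hμ.biUnion fun x _ => hκ x

theorem expect_bind {κ : α → PMF γ} (hμ : μ.support.Finite) (hκ : ∀ x, (κ x).support.Finite)
    (φ : γ → ℝ) : expect (μ.bind κ) φ = expect μ fun x => expect (κ x) φ := by
  have hb := finite_support_bind hμ hκ
  rw [expect_eq_sum hμ.coe_toFinset.ge, expect_eq_sum hb.coe_toFinset.ge]
  have h1 : ∀ x ∈ hμ.toFinset,
      expect (κ x) φ = ∑ y ∈ hb.toFinset, (κ x y).toReal * φ y := fun x hx => by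
    refine expect_eq_sum (fun y hy => ?_) φ
    rw [hb.coe_toFinset, PMF.mem_support_bind_iff]
    exact ⟨x, hμ.mem_toFinset.1 hx, hy⟩
  have h2 : ∀ y, (μ.bind κ y).toReal = ∑ x ∈ hμ.toFinset, (μ x).toReal * (κ x y).toReal := by
    intro y
    rw [PMF.bind_apply, tsum_eq_sum (s := hμ.toFinset), ENNReal.toReal_sum]
    · simp only [ENNReal.toReal_mul]
    · exact fun x _ => ENNReal.mul_ne_top (μ.apply_ne_top x) ((κ x).apply_ne_top y)
    · intro x hx
      have : μ x = 0 := by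
        rw [PMF.apply_eq_zero_iff]
        exact fun h => hx (hμ.mem_toFinset.2 h)
      simp [this]
  simp only [h2, Finset.sum_mul]
  rw [Finset.sum_comm]
  refine Finset.sum_congr rfl fun x hx => ?_
  rw [h1 x hx, Finset.mul_sum]
  exact Finset.sum_congr rfl fun y _ => mul_assoc _ _ _

theorem finite_support_map (g : α → γ) (hμ : μ.support.Finite) : (μ.map g).support.Finite := by
  rw [PMF.support_map]
  exact hμ.image g

theorem expect_map (g : α → γ) (hμ : μ.support.Finite) (φ : γ → ℝ) :
    expect (μ.map g) φ = expect μ fun x => φ (g x) := by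
  rw [← PMF.bind_pure_comp, expect_bind hμ fun x => by simp]
  simp only [Function.comp_apply, expect_pure]

end expect

instance : Finite Rate :=
  Finite.of_injective (fun r : Rate => (Rate.rec true false r : Bool)) (by
    rintro (_ | _) (_ | _) h <;> first | rfl | simp at h)

namespace Channel

variable (M : Channel)

/-! ### The expected cost of the first stages -/

theorem expect_transition (a : M.State) (r : Rate) (φ : M.State → ℝ) :
    expect (M.transition a r) φ = M.p r * φ (M.grow a r) + (1 - M.p r) * φ (M.reset r) := by
  rw [transition, expect_map _ (Set.toFinite _), expect, tsum_bool]
  have h1 := (M.p_pos r).le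
  have h2 := (M.p_lt_one r).le
  simp [failure, ENNReal.toReal_ofReal, h1, h2, add_comm]

theorem finite_support_transition (a : M.State) (r : Rate) : (M.transition a r).support.Finite :=
  finite_support_map _ (Set.toFinite _)

theorem finite_support_law (π : M.Policy) (s : M.State) (n : ℕ) :
    (M.law π s n).support.Finite := by
  induction n with
  | zero => simp [law]
  | succ n ih =>
    exact finite_support_bind ih fun x => finite_support_bind (Set.toFinite _) fun r =>
      finite_support_map _ (M.finite_support_transition _ _)

theorem expect_law_zero (π : M.Policy) (s : M.State) (φ : M.History × M.State → ℝ) :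
    expect (M.law π s 0) φ = φ ([], s) := expect_pure _ _

theorem expect_law_succ (π : M.Policy) (s : M.State) (n : ℕ) (φ : M.History × M.State → ℝ) :
    expect (M.law π s (n + 1)) φ = expect (M.law π s n) fun x => expect (π x.1 x.2) fun r =>
      M.p r * φ ((x.2, r) :: x.1, M.grow x.2 r) +
        (1 - M.p r) * φ ((x.2, r) :: x.1, M.reset r) := by
  have h1 : ∀ (x : M.History × M.State) (r : Rate),
      ((M.transition x.2 r).map fun a' => ((x.2, r) :: x.1, a')).support.Finite :=
    fun x r => finite_support_map _ (M.finite_support_transition _ _)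
  rw [law, expect_bind (M.finite_support_law π s n)
    fun x => finite_support_bind (Set.toFinite _) (h1 x)]
  congr 1
  funext x
  rw [expect_bind (Set.toFinite _) (h1 x)]
  congr 1
  funext r
  rw [expect_map _ (M.finite_support_transition _ _), expect_transition]

theorem age_nonneg (a : M.State) : (0 : ℝ) ≤ a := by
  obtain ⟨_, l, v, rfl⟩ := a
  have h1 := (M.d_pos .low).le
  have h2 := (M.d_pos .high).le
  positivity

/-- The expected age is bounded along every policy, because in each stage it is multiplied by a
factor below one and raised by a bounded amount. -/
theorem exists_expect_age_le (s : M.State) : ∃ B : ℝ, ∀ (π : M.Policy) (n : ℕ),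
    expect (M.law π s n) (fun x => (x.2 : ℝ)) ≤ B := by
  obtain ⟨ρ, hρ0, hρ1, hρ⟩ : ∃ ρ : ℝ, 0 ≤ ρ ∧ ρ < 1 ∧ ∀ r, M.p r ≤ ρ := by
    refine ⟨max (M.p .low) (M.p .high), (M.p_pos _).le.trans (le_max_left _ _),
      max_lt (M.p_lt_one _) (M.p_lt_one _), ?_⟩
    rintro (_ | _)
    exacts [le_max_left _ _, le_max_right _ _]
  obtain ⟨b, hb0, hb⟩ : ∃ b : ℝ, 0 ≤ b ∧ ∀ r, M.d r ≤ b := by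
    refine ⟨max (M.d .low) (M.d .high), (M.d_pos _).le.trans (le_max_left _ _), ?_⟩
    rintro (_ | _)
    exacts [le_max_left _ _, le_max_right _ _]
  -- `B` is at least the initial age and is mapped below itself by `x ↦ ρ * x + b`.
  refine ⟨s + b / (1 - ρ), fun π n => ?_⟩
  have h1 : 0 < 1 - ρ := by linarith
  have hs := M.age_nonneg s
  have hstep : ρ * (s + b / (1 - ρ)) + b ≤ s + b / (1 - ρ) := by
    have : b / (1 - ρ) - ρ * (b / (1 - ρ)) = b := by field_simp
    nlinarith
  induction n with
  | zero =>
    rw [expect_law_zero]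
    have : 0 ≤ b / (1 - ρ) := by positivity
    dsimp only
    linarith
  | succ n ih =>
    rw [expect_law_succ]
    refine le_trans ?_ hstep
    calc _ ≤ expect (M.law π s n) (fun x => ρ * (x.2 : ℝ) + b) := by
          refine expect_mono (M.finite_support_law π s n) fun x => ?_
          rw [← expect_const (π x.1 x.2) (ρ * (x.2 : ℝ) + b)]
          refine expect_mono (Set.toFinite _) fun r => ?_
          have := mul_le_mul_of_nonneg_right (hρ r) (M.age_nonneg x.2)
          simp only [grow, reset]
          linarith [hb r]
      _ = ρ * expect (M.law π s n) (fun x => (x.2 : ℝ)) + b := by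
          rw [expect_add (M.finite_support_law π s n), expect_const_mul, expect_const]
      _ ≤ _ := by gcongr

/-- The cost of using rate `r` at age `a` when the costs to come are given by `h`. -/
noncomputable def stageValue (β : ℝ) (h : M.State → ℝ) (a : M.State) (r : Rate) : ℝ :=
  M.cost β a r + M.p r * h (M.grow a r) + (1 - M.p r) * h (M.reset r)

theorem expect_totalCost_add_succ (β : ℝ) (π : M.Policy) (s : M.State) (h : M.State → ℝ) (n : ℕ) :
    expect (M.law π s (n + 1)) (fun x => M.totalCost β x.1 + h x.2) =
      expect (M.law π s n) fun x => expect (π x.1 x.2) fun r =>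
        M.totalCost β x.1 + M.stageValue β h x.2 r := by
  rw [expect_law_succ]
  congr! 4 with x r
  simp only [totalCost, List.map_cons, List.sum_cons, stageValue]
  ring

theorem expectedCost_eq (β : ℝ) (π : M.Policy) (s : M.State) (h : M.State → ℝ) (n : ℕ) :
    M.expectedCost β π s n = expect (M.law π s n) (fun x => M.totalCost β x.1 + h x.2) -
      expect (M.law π s n) fun x => h x.2 := by
  rw [expect_add (M.finite_support_law π s n), add_sub_cancel_right]
  rfl

theorem tendsto_add_mul_div (g c : ℝ) :
    Tendsto (fun n : ℕ => (((c + n * g) / n : ℝ) : EReal)) atTop (𝓝 (g : EReal)) := by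
  refine (continuous_coe_real_ereal.tendsto g).comp ?_
  have h1 : Tendsto (fun n : ℕ => c / (n : ℝ) + g) atTop (𝓝 (0 + g)) :=
    (tendsto_const_div_atTop_nhds_zero_nat c).add_const g
  rw [zero_add] at h1
  refine h1.congr' ?_
  filter_upwards [eventually_gt_atTop 0] with n hn
  have : (n : ℝ) ≠ 0 := by positivity
  field_simp

variable {M} {β g A B : ℝ} {h : M.State → ℝ}

/-- A subsolution of the average cost optimality equation that grows at most linearly bounds the
average cost of every policy from below. -/
theorem le_averageCost (hsub : ∀ a r, h a + g ≤ M.stageValue β h a r) (hA : 0 ≤ A)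
    (hgrowth : ∀ a : M.State, h a ≤ A * a + B) (π : M.Policy) (s : M.State) :
    (g : EReal) ≤ M.averageCost β π s := by
  obtain ⟨b, hb⟩ := M.exists_expect_age_le s
  have h1 : ∀ n : ℕ, h s + n * g ≤
      expect (M.law π s n) (fun x => M.totalCost β x.1 + h x.2) := fun n => by
    induction n with
    | zero => simp [expect_law_zero, totalCost]
    | succ n ih =>
      have hfin := M.finite_support_law π s n
      have : expect (M.law π s n) (fun x => (M.totalCost β x.1 + h x.2) + g) ≤
          expect (M.law π s (n + 1)) (fun x => M.totalCost β x.1 + h x.2) := by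
        rw [expect_totalCost_add_succ]
        refine expect_mono hfin fun x => ?_
        rw [← expect_const (π x.1 x.2) (M.totalCost β x.1 + h x.2 + g)]
        exact expect_mono (Set.toFinite _) fun r => by linarith [hsub x.2 r]
      rw [expect_add hfin, expect_const] at this
      push_cast
      linarith
  have h2 : ∀ n : ℕ, expect (M.law π s n) (fun x => h x.2) ≤ A * b + B := fun n => by
    have hfin := M.finite_support_law π s n
    calc _ ≤ expect (M.law π s n) (fun x => A * (x.2 : ℝ) + B) :=
          expect_mono hfin fun x => hgrowth x.2
      _ = A * expect (M.law π s n) (fun x => (x.2 : ℝ)) + B := by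
          rw [expect_add hfin, expect_const_mul, expect_const]
      _ ≤ _ := by gcongr; exact hb π n
  rw [← (tendsto_add_mul_div g (h s - (A * b + B))).limsup_eq]
  refine limsup_le_limsup (Eventually.of_forall fun n => ?_)
  rw [EReal.coe_le_coe_iff]
  gcongr
  rw [M.expectedCost_eq β π s h]
  linarith [h1 n, h2 n]

/-- A supersolution of the evaluation equation of a stationary policy that is bounded below by a
linear function bounds the average cost of that policy from above. -/
theorem averageCost_stationary_le {ζ : M.State → Rate}
    (hsup : ∀ a, M.stageValue β h a (ζ a) ≤ h a + g) (hA : 0 ≤ A)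
    (hgrowth : ∀ a : M.State, -(A * a + B) ≤ h a) (s : M.State) :
    M.averageCost β (M.stationary ζ) s ≤ g := by
  obtain ⟨b, hb⟩ := M.exists_expect_age_le s
  set π := M.stationary ζ
  have h1 : ∀ n : ℕ, expect (M.law π s n) (fun x => M.totalCost β x.1 + h x.2) ≤
      h s + n * g := fun n => by
    induction n with
    | zero => simp [expect_law_zero, totalCost]
    | succ n ih =>
      have hfin := M.finite_support_law π s n
      have : expect (M.law π s (n + 1)) (fun x => M.totalCost β x.1 + h x.2) ≤
          expect (M.law π s n) (fun x => (M.totalCost β x.1 + h x.2) + g) := by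
        rw [expect_totalCost_add_succ]
        refine expect_mono hfin fun x => ?_
        simp only [π, stationary, expect_pure]
        linarith [hsup x.2]
      rw [expect_add hfin, expect_const] at this
      push_cast
      linarith
  have h2 : ∀ n : ℕ, -(A * b + B) ≤ expect (M.law π s n) (fun x => h x.2) := fun n => by
    have hfin := M.finite_support_law π s n
    calc -(A * b + B) ≤ -A * expect (M.law π s n) (fun x => (x.2 : ℝ)) + -B := by
          have := mul_le_mul_of_nonneg_left (hb π n) hA
          linarith
      _ = expect (M.law π s n) (fun x => -A * (x.2 : ℝ) + -B) := by
          rw [expect_add hfin, expect_const_mul, expect_const]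
      _ ≤ _ := expect_mono hfin fun x => by linarith [hgrowth x.2]
  rw [← (tendsto_add_mul_div g (h s + (A * b + B))).limsup_eq]
  refine limsup_le_limsup (Eventually.of_forall fun n => ?_)
  rw [EReal.coe_le_coe_iff]
  gcongr
  rw [M.expectedCost_eq β π s h]
  linarith [h1 n, h2 n]

end Channel

/-! ### Threshold policies from a monotone advantage -/

/-- A zero of `f` serves as the threshold. Without a sign change the threshold is `⊤` if `f` is
nonpositive and `0` if `f` is nonnegative; in the latter case `f` may be positive at `0`, which is why
nothing is claimed there. -/
theorem exists_threshold_of_monotone {f : ℝ≥0 → ℝ} (hf : Monotone f) (hc : Continuous f) :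
    ∃ θ : EReal, 0 ≤ θ ∧ ((∃ a, 0 < f a) → θ ≠ ⊤) ∧ ∀ a : ℝ≥0, 0 < a →
      (((a : ℝ) : EReal) ≤ θ → f a ≤ 0) ∧ (θ < ((a : ℝ) : EReal) → 0 ≤ f a) := by
  by_cases hneg : ∀ a, f a ≤ 0
  · refine ⟨⊤, le_top, fun ⟨a, ha⟩ => absurd (hneg a) ha.not_ge, fun a _ => ⟨fun _ => hneg a, ?_⟩⟩
    exact fun h => absurd h (not_lt.2 le_top)
  by_cases hpos : ∀ a, 0 ≤ f a
  · refine ⟨0, le_rfl, fun _ => EReal.zero_ne_top, fun a ha => ⟨fun h => ?_, fun _ => hpos a⟩⟩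
    have : (a : ℝ) ≤ 0 := by exact_mod_cast h
    exact absurd ha (not_lt.2 (by exact_mod_cast this))
  push Not at hneg hpos
  obtain ⟨x, hx⟩ := hneg
  obtain ⟨y, hy⟩ := hpos
  obtain ⟨t, ht⟩ : (0 : ℝ) ∈ Set.range f :=
    mem_range_of_exists_le_of_exists_ge hc ⟨y, hy.le⟩ ⟨x, hx.le⟩
  refine ⟨((t : ℝ) : EReal), by exact_mod_cast t.coe_nonneg, fun _ => EReal.coe_ne_top _,
    fun a _ => ⟨fun h => ?_, fun h => ?_⟩⟩
  · rw [← ht]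
    exact hf (by exact_mod_cast h)
  · rw [← ht]
    exact hf (le_of_lt (by exact_mod_cast h))

namespace Channel

variable (M : Channel)

/-- The average cost optimality equation holds for the linear function plus the fixed point of
`bellman`; age `0` is never visited again, so the choice made there is immaterial, and the relative
value at age `0` may be that of the threshold policy. -/
theorem exists_threshold_isAverageOptimal (β : ℝ) (u v : Rate) (huv : ∀ r, r = u ∨ r = v)
    (hslope : M.d v * (1 - M.p u) ≤ M.d u * (1 - M.p v)) :
    ∃ θ : EReal, 0 ≤ θ ∧ (M.d v * (1 - M.p u) < M.d u * (1 - M.p v) → θ ≠ ⊤) ∧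
      M.IsAverageOptimal β (M.stationary (M.threshold u v θ)) := by
  have hqu : 0 < 1 - M.p u := sub_pos.2 (M.p_lt_one u)
  have hqv : 0 < 1 - M.p v := sub_pos.2 (M.p_lt_one v)
  -- `m` is the slope of the expected cost until the first success when rate `v` is used throughout.
  obtain ⟨m, hm⟩ : ∃ m, m = M.d v / (1 - M.p v) := ⟨_, rfl⟩
  have hm0 : 0 ≤ m := by
    rw [hm]
    exact div_nonneg (M.d_pos v).le hqv.le
  have hdv : M.d v = (1 - M.p v) * m := by
    rw [hm]
    field_simp
  have he : (1 - M.p v) * (M.d u - (1 - M.p u) * m) =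
      M.d u * (1 - M.p v) - M.d v * (1 - M.p u) := by
    rw [hdv]; ring
  obtain ⟨e, hedef⟩ : ∃ e : ℝ≥0, (e : ℝ) = M.d u - (1 - M.p u) * m := by
    refine ⟨⟨_, nonneg_of_mul_nonneg_right (?_ : 0 ≤ (1 - M.p v) * _) hqv⟩, rfl⟩
    rw [he]; linarith
  rw [← hedef] at he
  obtain ⟨g, δ, hkv, hku⟩ := M.exists_value_reset_eq u v e
    (-β * M.d u + 1 / 2 * M.d u ^ 2 + M.p u * m * M.d u)
    (-β * M.d v + 1 / 2 * M.d v ^ 2 + M.p v * m * M.d v)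
    (-(m * M.d v)) (m * M.d u) (1 - M.p u) hqu.le (by linarith [M.p_pos u])
  set w : ℝ × ℝ := (-β * M.d u + 1 / 2 * M.d u ^ 2 + M.p u * m * M.d u - g + (1 - M.p u) * δ,
    -β * M.d v + 1 / 2 * M.d v ^ 2 + M.p v * m * M.d v - g) with hw
  set k := M.value u v e w with hk
  let age : M.State → ℝ≥0 := fun a => ⟨a, M.age_nonneg a⟩
  let h : M.State → ℝ := fun a => m * a + k (age a)
  have hQu : ∀ a, M.stageValue β h a u =
      m * a + (e * age a + w.1 + M.p u * k (age a + M.delay u)) + g := fun a => by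
    have h1 : h (M.grow a u) = m * (a + M.d u) + k (age a + M.delay u) := rfl
    have h2 : h (M.reset u) = m * M.d u + k (M.delay u) := rfl
    have h3 : (age a : ℝ) = a := rfl
    rw [stageValue, h1, h2, h3, hku, cost, hw, hedef]
    ring
  have hQv : ∀ a, M.stageValue β h a v =
      m * a + (w.2 + M.p v * k (age a + M.delay v)) + g := fun a => by
    have h1 : h (M.grow a v) = m * (a + M.d v) + k (age a + M.delay v) := rfl
    have h2 : h (M.reset v) = m * M.d v + k (M.delay v) := rfl
    have h3 : (a : ℝ) * M.d v = (1 - M.p v) * m * a := by rw [← hdv]; ring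
    rw [stageValue, h1, h2, hkv, cost, hw, sub_mul, h3]
    ring
  have hacoe : ∀ a, h a + g = min (M.stageValue β h a u) (M.stageValue β h a v) := fun a => by
    rw [hQu, hQv, min_add_add_right, min_add_add_left]
    simp only [h]
    rw [hk, ← value_eq]
  have hadv : ∀ a, M.stageValue β h a u - M.stageValue β h a v =
      w.1 - w.2 + M.advantage u v e k (age a) := fun a => by
    rw [hQu, hQv, advantage]
    ring
  have hnorm : ∀ b, |k b| ≤ ‖k‖ := fun b => k.norm_coe_le_norm b
  have hsub : ∀ a r, h a + g ≤ M.stageValue β h a r := fun a r => by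
    rw [hacoe]
    rcases huv r with rfl | rfl
    exacts [min_le_left _ _, min_le_right _ _]
  obtain ⟨θ, hθ0, hθtop, hθ⟩ := exists_threshold_of_monotone
    (f := fun a => w.1 - w.2 + M.advantage u v e k a)
    ((M.monotone_advantage_value u v e w).const_add _)
    (continuous_const.add (M.continuous_advantage u v e k))
  refine ⟨θ, hθ0, fun hlt => hθtop ?_, fun s π' => ?_⟩
  · have hslope_pos : 0 < (1 - M.p v) * e := by
      rw [he]; linarith
    obtain ⟨n, hn⟩ :=
      exists_nat_gt ((-(w.1 - w.2 + M.advantage u v e k 0)) / ((1 - M.p v) * e))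
    refine ⟨n, ?_⟩
    have h1 := M.le_advantage_value u v e w n
    rw [div_lt_iff₀ hslope_pos] at hn
    rw [NNReal.coe_natCast] at h1
    linarith
  set ζ := M.threshold u v θ with hζ
  have hzeta : ∀ a : M.State, (a : ℝ) ≠ 0 → M.stageValue β h a (ζ a) ≤ h a + g := fun a ha => by
    have hpos : 0 < age a := NNReal.coe_pos.1 (lt_of_le_of_ne (M.age_nonneg a) (Ne.symm ha))
    obtain ⟨h1, h2⟩ := hθ (age a) hpos
    have h3 := hadv a
    rw [hacoe, hζ, threshold]
    split_ifs with hle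
    · exact le_min le_rfl (by linarith [h1 hle])
    · exact le_min (by linarith [h2 (not_le.1 hle)]) le_rfl
  classical
  let h' : M.State → ℝ := fun a => if (a : ℝ) = 0 then M.stageValue β h a (ζ a) - g else h a
  have hle : ∀ a, h a ≤ h' a := fun a => by
    simp only [h']
    split_ifs
    · linarith [hsub a (ζ a)]
    · exact le_rfl
  have hstage : ∀ a r, M.stageValue β h' a r = M.stageValue β h a r := fun a r => by
    have h1 : ((M.grow a r : M.State) : ℝ) ≠ 0 :=
      (add_pos_of_nonneg_of_pos (M.age_nonneg a) (M.d_pos r)).ne'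
    have h2 : ((M.reset r : M.State) : ℝ) ≠ 0 := (M.d_pos r).ne'
    simp only [stageValue, h', if_neg h1, if_neg h2]
  refine le_trans (averageCost_stationary_le (h := h') (g := g) (A := 0) (B := ‖k‖) (fun a => ?_)
    le_rfl (fun a => ?_) s) (le_averageCost hsub hm0 (B := ‖k‖) (fun a => ?_) π' s)
  · rw [hstage]
    by_cases ha : (a : ℝ) = 0
    · simp only [h', if_pos ha, sub_add_cancel, le_refl]
    · simp only [h', if_neg ha]
      exact hzeta a ha
  · refine le_trans ?_ (hle a)
    have h1 := mul_nonneg hm0 (M.age_nonneg a)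
    have h2 := (abs_le.1 (hnorm (age a))).1
    simp only [h]
    linarith
  · have h2 := (abs_le.1 (hnorm (age a))).2
    simp only [h]
    linarith

end Channel

end AgeMDP

theorem theorem1 (M : AgeMDP.Channel) (β : ℝ) :
    (M.d .low * (1 - M.p .high) ≤ M.d .high * (1 - M.p .low) →
      ∃ θ : EReal, 0 ≤ θ ∧
        (M.d .low * (1 - M.p .high) < M.d .high * (1 - M.p .low) → θ ≠ ⊤) ∧
        M.IsAverageOptimal β (M.stationary (M.threshold .high .low θ))) ∧
    (M.d .high * (1 - M.p .low) ≤ M.d .low * (1 - M.p .high) →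
      ∃ θ : EReal, 0 ≤ θ ∧
        (M.d .high * (1 - M.p .low) < M.d .low * (1 - M.p .high) → θ ≠ ⊤) ∧
        M.IsAverageOptimal β (M.stationary (M.threshold .low .high θ))) := by
  refine ⟨M.exists_threshold_isAverageOptimal β .high .low ?_,
    M.exists_threshold_isAverageOptimal β .low .high ?_⟩ <;> rintro (_ | _) <;> simp
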